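/- Let $(X,\rho)$ be a nonempty, complete, locally compact $\mathbb R$-tree: any two points are joined by a unique segment (isometric image of a compact interval), and every side of a triangle is contained in the union of the other two. Let $\mathcal O_+(X)$ be the set of partial orders $\tau$ on $X$ such that (i) any two points $x,y$ have a supremum $x\vee y$; (ii) $x\preceq z\preceq y$ implies $\rho(x,z)+\rho(z,y)=\rho(x,y)$; (iii) $\rho(x,y)=\rho(x,x\vee y)+\rho(x\vee y,y)$ for all $x,y$; (iv) every upper cone $U_x=\{y: x\preceq y\}$ is linearly ordered. Let $\mathcal O_+^r(X)$ be the subset of the orders that have a root (greatest element), with the Hausdorff distance $\operatorname{Hd}$ of orders viewed as subsets of $X\times X$ with the sum metric $d_+((x_1,x_2),(y_1,y_2))=\rho(x_1,y_1)+\rho(x_2,y_2)$. Give $\mathcal O_+(X)$ the topology generated by the open sets of $(\mathcal O_+^r(X),\operatorname{Hd})$ and the sets $\mathcal U_{(x,y)}$, $x\neq y$, of all $\tau\in\mathcal O_+(X)$ with $x\,\tau\,y$ whose root is not $y$. Let the metric compactification $\overline X_m$ be the closure of $\{[\rho(x,\cdot)]: x\in X\}$ in the quotient of $C(X,\mathbb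 R)$ (compact-open topology) by the constant functions. Then: 1. For rooted orders $\sigma,\tau$ with roots $x,y$ one has $\operatorname{Hd}(\sigma,\tau)=\rho(x,y)$, and the map sending a rooted order to its root is an isometry of $\mathcal O_+^r(X)$ onto $X$. 2. There is a homeomorphism $\Phi:\mathcal O_+(X)\to\overline X_m$ such that $\Phi(\tau)=[\rho(x,\cdot)]$ if $\tau$ has root $x$, while, if $\tau$ has no root, then each upper cone $U_x$ is (the image of) a ray starting at $x$, and for every ray $c$ asymptotic to $U_x$ (that is, at bounded distance from its natural parameterization), $\Phi(\tau)$ is the class of the Busemann function $\beta_c(y)=\lim_{t\to+\infty}(\rho(y,c(t))-t)$. -/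

import Mathlib

open Set Filter Topology
open scoped NNReal ENNReal

noncomputable section

/-! ### Segments, ℝ-trees, rays -/

/-- `S` is (the image of) a segment from `x` to `y`: it has a natural parameterization, that is an
isometric one, by the real interval `[0, dist x y]`. -/
def IsSegment {X : Type*} [MetricSpace X] (x y : X) (S : Set X) : Prop :=
  ∃ γ : ℝ → X, γ 0 = x ∧ γ (dist x y) = y ∧
    (∀ s ∈ Icc 0 (dist x y), ∀ t ∈ Icc 0 (dist x y), dist (γ s) (γ t) = |s - t|) ∧
    S = γ '' Icc 0 (dist x y)

/-- An ℝ-tree: any two points are joined by a unique segment, and each side of a triangle lies in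
the union of the two other sides. -/
structure IsRTree (X : Type*) [MetricSpace X] : Prop where
  existsUnique_segment : ∀ x y : X, ∃! S : Set X, IsSegment x y S
  subset_union : ∀ (x y z : X) (Sxy Sxz Syz : Set X),
    IsSegment x y Sxy → IsSegment x z Sxz → IsSegment y z Syz → Sxy ⊆ Sxz ∪ Syz

/-- A naturally parameterized ray `[0, +∞) → X`. -/
def IsRay {X : Type*} [MetricSpace X] (c : ℝ≥0 → X) : Prop := Isometry c

/-- Two rays are asymptotic if they stay at bounded distance. -/
def Asymptotic {X : Type*} [MetricSpace X] (c d : ℝ≥0 → X) : Prop :=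
  ∃ C : ℝ, ∀ t, dist (c t) (d t) ≤ C

/-! ### Upper semilinear metric ∨-semilattice orders -/

/-- The metric space `X` with its partial order is a metric ∨-semilattice. -/
structure IsMetricSupSemilattice (X : Type*) [MetricSpace X] [PartialOrder X] : Prop where
  exists_isLUB : ∀ x y : X, ∃ w : X, IsLUB {x, y} w
  dist_add_dist : ∀ x y z : X, x ≤ z → z ≤ y → dist x z + dist z y = dist x y
  dist_eq_of_isLUB : ∀ x y w : X, IsLUB {x, y} w → dist x y = dist x w + dist w y

/-- A partial order is upper semilinear if all its upper cones are linearly ordered. -/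
def IsUpperSemilinear (X : Type*) [PartialOrder X] : Prop :=
  ∀ x : X, IsChain (· ≤ ·) (Ici x)

/-- The set `𝒪₊(X)` of the partial orders on `X` for which `X` is an upper semilinear metric
∨-semilattice. -/
structure SemilinearOrder (X : Type*) [MetricSpace X] where
  order : PartialOrder X
  isMetricSupSemilattice : @IsMetricSupSemilattice X _ order
  isUpperSemilinear : @IsUpperSemilinear X order

namespace SemilinearOrder

variable {X : Type*} [MetricSpace X]

/-- The order relation of `τ`. -/
def Rel (τ : SemilinearOrder X) (x y : X) : Prop := τ.order.le x y

/-- The upper cone of `x`. -/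
def upperCone (τ : SemilinearOrder X) (x : X) : Set X := {y | τ.Rel x y}

/-- `x` is the root, that is the greatest element, of `τ`. -/
def IsRoot (τ : SemilinearOrder X) (x : X) : Prop := ∀ y, τ.Rel y x

/-- `τ` has a root. -/
def IsRooted (τ : SemilinearOrder X) : Prop := ∃ x, τ.IsRoot x

/-- The order as a subset of the metric square `X × X`; `WithLp 1` is the sum metric
`dist (x₁, x₂) (y₁, y₂) = dist x₁ y₁ + dist x₂ y₂`. -/
def graph (τ : SemilinearOrder X) : Set (WithLp 1 (X × X)) := {p | τ.Rel p.fst p.snd}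

end SemilinearOrder

/-- The set `𝒪₊ʳ(X)` of rooted orders. -/
structure RootedOrder (X : Type*) [MetricSpace X] where
  val : SemilinearOrder X
  isRooted : val.IsRooted

/-- The Hausdorff distance on rooted orders, induced by the sum metric of `X × X`. -/
instance RootedOrder.instPseudoEMetricSpace (X : Type*) [MetricSpace X] :
    PseudoEMetricSpace (RootedOrder X) where
  edist σ τ := Metric.hausdorffEDist σ.val.graph τ.val.graph
  edist_self _ := Metric.hausdorffEDist_self
  edist_comm _ _ := Metric.hausdorffEDist_comm
  edist_triangle _ _ _ := Metric.hausdorffEDist_triangle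

namespace SemilinearOrder

/-- The set `𝒰₍ₓ,ᵧ₎` of the orders in which `x` is below `y`, without the order with root `y`. -/
def basicNhd {X : Type*} [MetricSpace X] (x y : X) : Set (SemilinearOrder X) :=
  {τ | τ.Rel x y} \ {τ | τ.IsRoot y}

/-- The base of the topology: the open sets of the metric space of rooted orders, and the sets
`basicNhd x y` for `x ≠ y`. -/
def base (X : Type*) [MetricSpace X] : Set (Set (SemilinearOrder X)) :=
  {U | ∃ V : Set (RootedOrder X), IsOpen V ∧ U = RootedOrder.val '' V} ∪
    {U | ∃ x y : X, x ≠ y ∧ U = basicNhd x y}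

instance instTopologicalSpace (X : Type*) [MetricSpace X] :
    TopologicalSpace (SemilinearOrder X) :=
  TopologicalSpace.generateFrom (base X)

end SemilinearOrder

/-! ### The metric compactification -/

/-- The constant functions in `C(X, ℝ)`. -/
def constFunctions (X : Type*) [TopologicalSpace X] : Submodule ℝ C(X, ℝ) where
  carrier := {f | ∃ a : ℝ, f = ContinuousMap.const X a}
  zero_mem' := ⟨0, rfl⟩
  add_mem' := by
    rintro _ _ ⟨a, rfl⟩ ⟨b, rfl⟩
    exact ⟨a + b, rfl⟩
  smul_mem' := by
    rintro r _ ⟨a, rfl⟩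
    exact ⟨r * a, rfl⟩

/-- `C*(X, ℝ)`: continuous functions with the compact-open topology, modulo constants. -/
abbrev FunctionsModConst (X : Type*) [TopologicalSpace X] : Type _ :=
  C(X, ℝ) ⧸ constFunctions X

/-- The class modulo constants of a continuous function. -/
def classModConst {X : Type*} [TopologicalSpace X] (f : C(X, ℝ)) : FunctionsModConst X :=
  (constFunctions X).mkQ f

/-- The distance function of `x`. Its normalization by a base point `o`,
`y ↦ dist x y - dist o x`, has the same class modulo constants. -/
def distFunction {X : Type*} [MetricSpace X] (x : X) : C(X, ℝ) where
  toFun y := dist x y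
  continuous_toFun := by fun_prop

/-- The metric (horofunction) compactification: the closure in `C*(X, ℝ)` of the set of classes of
distance functions. -/
def metricCompactification (X : Type*) [MetricSpace X] : Set (FunctionsModConst X) :=
  closure (range fun x : X => classModConst (distFunction x))

/-- `β` is the Busemann function of the ray `c`. -/
def IsBusemannFunction {X : Type*} [MetricSpace X] (c : ℝ≥0 → X) (β : C(X, ℝ)) : Prop :=
  ∀ y, Tendsto (fun t : ℝ≥0 => dist y (c t) - (t : ℝ)) atTop (𝓝 (β y))

end

noncomputable section

/-! ### Betweenness in ℝ-trees -/

section Segments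

variable {X : Type*} [MetricSpace X]

/-! Orders in `SemilinearOrder X` correspond to functions on the tree, modulo constants, that are
1-Lipschitz and along each segment descend with slope `-1`, then ascend with slope `1`
(`IsTreeHorofunction`). From an order one gets the height `dist x w - dist y w`, independent of the
common upper bound `w` (`dist_sub_dist_eq`); from a function one gets the order "slope `-1` from `x`
to `y`", with joins at the turning points of segments (`exists_join`). The order with root `x`
corresponds to the distance function of `x`.

The horofunction conditions are closed and hold for distance functions, hence on the whole
compactification. Conversely, the height of an unrooted order agrees on any ball, up to a constant,
with the distance function of a remote point of an upper cone (`rel_of_dist_lt`), so its class is a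
limit of distance classes. The same localization gives continuity and the Busemann formula.
Continuity of the inverse is checked on the two kinds of base sets; local compactness enters only
near rooted orders. -/

theorem IsSegment.dist_add_dist {x y z : X} {S : Set X} (hS : IsSegment x y S) (hz : z ∈ S) :
    dist x z + dist z y = dist x y := by
  obtain ⟨γ, h0, h1, hγ, rfl⟩ := hS
  obtain ⟨t, ht, rfl⟩ := hz
  have hd : (0 : ℝ) ≤ dist x y := dist_nonneg
  have e1 := hγ 0 ⟨le_rfl, hd⟩ t ht
  have e2 := hγ t ht _ ⟨hd, le_rfl⟩
  rw [h0] at e1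
  rw [h1] at e2
  rw [e1, e2, abs_of_nonpos (by linarith [ht.1]), abs_of_nonpos (by linarith [ht.2])]
  ring

theorem IsRTree.exists_isSegment (hX : IsRTree X) (x y : X) : ∃ S, IsSegment x y S :=
  (hX.existsUnique_segment x y).exists

theorem IsRTree.exists_dist_eq (hX : IsRTree X) (x y : X) {t : ℝ} (ht : t ∈ Icc 0 (dist x y)) :
    ∃ z, dist x z = t ∧ dist z y = dist x y - t := by
  obtain ⟨S, γ, h0, h1, hγ, -⟩ := hX.exists_isSegment x y
  have hd : (0 : ℝ) ≤ dist x y := dist_nonneg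
  have e1 := hγ 0 ⟨le_rfl, hd⟩ t ht
  have e2 := hγ t ht _ ⟨hd, le_rfl⟩
  rw [h0] at e1
  rw [h1] at e2
  refine ⟨γ t, ?_, ?_⟩
  · rw [e1, abs_of_nonpos (by linarith [ht.1])]; ring
  · rw [e2, abs_of_nonpos (by linarith [ht.2])]; ring

/-- A point metrically between `x` and `y` lies on a segment from `x` to `y`. -/
theorem IsRTree.exists_isSegment_mem (hX : IsRTree X) {x y z : X}
    (h : dist x z + dist z y = dist x y) : ∃ S, IsSegment x y S ∧ z ∈ S := by
  obtain ⟨S₁, γ₁, a0, a1, aγ, -⟩ := hX.exists_isSegment x z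
  obtain ⟨S₂, γ₂, b0, b1, bγ, -⟩ := hX.exists_isSegment z y
  have hp : (0 : ℝ) ≤ dist x z := dist_nonneg
  have hq : (0 : ℝ) ≤ dist z y := dist_nonneg
  set p := dist x z
  set q := dist z y
  let γ : ℝ → X := fun s => if s ≤ p then γ₁ s else γ₂ (s - p)
  have key : ∀ s ∈ Icc 0 (dist x y), ∀ t ∈ Icc 0 (dist x y), s ≤ t →
      dist (γ s) (γ t) = t - s := by
    intro s hs t ht hst
    rw [← h] at hs ht
    by_cases h1 : t ≤ p
    · have h2 : s ≤ p := hst.trans h1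
      simp only [γ, h1, h2, if_true]
      rw [aγ s ⟨hs.1, h2⟩ t ⟨ht.1, h1⟩, abs_of_nonpos (by linarith)]; ring
    · by_cases h2 : s ≤ p
      · simp only [γ, h1, h2, if_true, if_false]
        have ht' : t - p ∈ Icc 0 q := ⟨by linarith, by linarith [ht.2]⟩
        have e1 := aγ 0 ⟨le_rfl, hp⟩ s ⟨hs.1, h2⟩
        have e2 := aγ s ⟨hs.1, h2⟩ p ⟨hp, le_rfl⟩
        have e3 := bγ 0 ⟨le_rfl, hq⟩ (t - p) ht'
        have e4 := bγ (t - p) ht' q ⟨hq, le_rfl⟩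
        rw [a0, abs_of_nonpos (by linarith [hs.1])] at e1
        rw [a1, abs_of_nonpos (by linarith)] at e2
        rw [b0, abs_of_nonpos (by linarith)] at e3
        rw [b1, abs_of_nonpos (by linarith [ht'.2])] at e4
        -- The path through `z` bounds the distance from above; the full length `dist x y` bounds it
        -- from below.
        have t1 := dist_triangle (γ₁ s) z (γ₂ (t - p))
        have t2 := dist_triangle4 x (γ₁ s) (γ₂ (t - p)) y
        linarith
      · simp only [γ, h1, h2, if_false]
        rw [bγ (s - p) ⟨by linarith, by linarith [hs.2]⟩ (t - p) ⟨by linarith, by linarith [ht.2]⟩,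
          abs_of_nonpos (by linarith)]
        ring
  refine ⟨γ '' Icc 0 (dist x y), ⟨γ, ?_, ?_, ?_, rfl⟩, p, ⟨hp, by linarith⟩, ?_⟩
  · simp only [γ, hp, if_true, a0]
  · by_cases h1 : dist x y ≤ p
    · have hq0 : q = 0 := by linarith
      have : z = y := dist_eq_zero.1 hq0
      have h2 : dist x y = p := by linarith
      simp only [γ, h2, le_refl, if_true, a1, this]
    · have h2 : dist x y - p = q := by linarith
      simp only [γ, h1, if_false, h2, b1]
  · intro s hs t ht
    rcases le_total s t with hst | hst
    · rw [key s hs t ht hst, abs_of_nonpos (by linarith)]; ring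
    · rw [dist_comm, key t ht s hs hst, abs_of_nonneg (by linarith)]
  · simp only [γ, le_refl, if_true, a1]

/-- Thinness of triangles in purely metric form, which lets later arguments avoid segments. -/
theorem IsRTree.dist_add_dist_or (hX : IsRTree X) {x y z : X}
    (h : dist x z + dist z y = dist x y) (w : X) :
    dist x z + dist z w = dist x w ∨ dist y z + dist z w = dist y w := by
  obtain ⟨S, hS, hz⟩ := hX.exists_isSegment_mem h
  obtain ⟨S₁, h₁⟩ := hX.exists_isSegment x w
  obtain ⟨S₂, h₂⟩ := hX.exists_isSegment y w
  exact (hX.subset_union x y w S S₁ S₂ hS h₁ h₂ hz).imp h₁.dist_add_dist h₂.dist_add_dist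

end Segments

/-! ### Horofunctions of a tree and the orders they define -/

/-- A function on a tree is a horofunction if it is 1-Lipschitz and if along each segment it is
first decreasing and then increasing, with slopes `-1` and `1`. -/
structure IsTreeHorofunction {X : Type*} [MetricSpace X] (h : X → ℝ) : Prop where
  sub_le_dist : ∀ x y, h x - h y ≤ dist x y
  le_max : ∀ x y z, dist x z + dist z y = dist x y → h z ≤ max (h x - dist x z) (h y - dist y z)

section Horofunction

variable {X : Type*} [MetricSpace X]

theorem IsRTree.isTreeHorofunction_dist (hX : IsRTree X) (w : X) :
    IsTreeHorofunction fun y => dist w y where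
  sub_le_dist x y := by
    have := dist_triangle w y x
    rw [dist_comm y x] at this
    linarith
  le_max x y z h := by
    rw [le_max_iff]
    refine (hX.dist_add_dist_or h w).imp (fun h => ?_) (fun h => ?_) <;>
    · rw [dist_comm w z, dist_comm w]
      linarith

/-- The turning point of `h` on the segment. The slopes `-1` and `1` force its distance from `x` to
be `(dist x y + (h x - h y)) / 2`, which the Lipschitz bound places in range. -/
theorem IsTreeHorofunction.exists_join {h : X → ℝ} (hh : IsTreeHorofunction h) (hX : IsRTree X)
    (x y : X) :
    ∃ p, dist x p + dist p y = dist x y ∧ h x - h p = dist x p ∧ h y - h p = dist y p := by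
  have h1 := hh.sub_le_dist x y
  have h2 := hh.sub_le_dist y x
  rw [dist_comm y x] at h2
  obtain ⟨p, e1, e2⟩ := hX.exists_dist_eq x y (t := (dist x y + (h x - h y)) / 2)
    ⟨by linarith, by linarith⟩
  have e3 : dist x p + dist p y = dist x y := by linarith
  have h3 := hh.sub_le_dist x p
  have h4 := hh.sub_le_dist y p
  have h5 := hh.le_max x y p e3
  rw [dist_comm y p] at h4 h5
  refine ⟨p, e3, ?_, ?_⟩ <;> (try rw [dist_comm y p]) <;> rcases le_max_iff.1 h5 with h | h <;> linarith

/-- In the order of a horofunction, `x ≤ y` if the function has slope `-1` from `x` to `y`. -/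
abbrev IsTreeHorofunction.partialOrder {h : X → ℝ} (hh : IsTreeHorofunction h) :
    PartialOrder X where
  le x y := h x - h y = dist x y
  le_refl x := by simp
  le_trans x y z hxy hyz := by
    have := dist_triangle x y z
    have := hh.sub_le_dist x z
    linarith
  le_antisymm x y hxy hyx := by
    rw [dist_comm] at hyx
    exact dist_eq_zero.1 (by linarith)

/-- The semilinear order of a horofunction. -/
def IsTreeHorofunction.semilinearOrder {h : X → ℝ} (hh : IsTreeHorofunction h)
    (hX : IsRTree X) : SemilinearOrder X := by
  letI := hh.partialOrder
  have le_iff : ∀ x y : X, x ≤ y ↔ h x - h y = dist x y := fun _ _ => Iff.rfl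
  have lub : ∀ x y p : X, dist x p + dist p y = dist x y → x ≤ p → y ≤ p → IsLUB {x, y} p := by
    intro x y p hp hxp hyp
    refine ⟨by simp [upperBounds, hxp, hyp], fun w hw => ?_⟩
    have hxw : x ≤ w := hw (by simp)
    have hyw : y ≤ w := hw (by simp)
    rw [le_iff] at *
    rcases hX.dist_add_dist_or hp w with h | h <;> linarith
  refine ⟨hh.partialOrder, ⟨fun x y => ?_, fun x y z hxz hzy => ?_, fun x y w hw => ?_⟩, ?_⟩
  · obtain ⟨p, h1, h2, h3⟩ := hh.exists_join hX x y
    exact ⟨p, lub x y p h1 h2 h3⟩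
  · have hxy := hxz.trans hzy
    rw [le_iff] at *
    linarith
  · obtain ⟨p, h1, h2, h3⟩ := hh.exists_join hX x y
    rw [hw.unique (lub x y p h1 h2 h3), h1]
  · intro x y hy z hz _
    replace hy : x ≤ y := hy
    replace hz : x ≤ z := hz
    -- The turning point `p` between `y` and `z` also lies between `x` and one of them, say `y`.
    -- Since `h` descends from `x` through `y` to `p`, this forces `p = y`.
    obtain ⟨p, h1, h2, h3⟩ := hh.exists_join hX y z
    have hyp : y ≤ p := h2
    have hzp : z ≤ p := h3
    rw [le_iff] at *
    rcases hX.dist_add_dist_or h1 x with h | h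
    · right
      have : dist y p = 0 := by
        rw [dist_comm p x, dist_comm y x] at h
        have := hh.sub_le_dist x p
        linarith [dist_nonneg (x := y) (y := p)]
      rw [dist_eq_zero.1 this]
      exact h3
    · left
      have : dist z p = 0 := by
        rw [dist_comm p x, dist_comm z x] at h
        have := hh.sub_le_dist x p
        linarith [dist_nonneg (x := z) (y := p)]
      rw [dist_eq_zero.1 this]
      exact h2

theorem IsTreeHorofunction.semilinearOrder_rel {h : X → ℝ} (hh : IsTreeHorofunction h)
    (hX : IsRTree X) (x y : X) :
    (hh.semilinearOrder hX).Rel x y ↔ h x - h y = dist x y :=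
  Iff.rfl

end Horofunction

/-! ### The horofunction of an order -/

namespace SemilinearOrder

variable {X : Type*} [MetricSpace X] (τ : SemilinearOrder X)

variable {τ} in
theorem Rel.trans {x y z : X} (h : τ.Rel x y) (h' : τ.Rel y z) : τ.Rel x z :=
  τ.order.le_trans x y z h h'

variable {τ} in
theorem Rel.antisymm {x y : X} (h : τ.Rel x y) (h' : τ.Rel y x) : x = y :=
  τ.order.le_antisymm x y h h'

theorem rel_refl (x : X) : τ.Rel x x :=
  τ.order.le_refl x

theorem ext_rel {σ τ : SemilinearOrder X} (h : ∀ x y, σ.Rel x y ↔ τ.Rel x y) : σ = τ := by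
  have : σ.order = τ.order := PartialOrder.ext h
  cases σ
  cases τ
  cases this
  rfl

theorem rel_or_rel {x y z : X} (hy : τ.Rel x y) (hz : τ.Rel x z) : τ.Rel y z ∨ τ.Rel z y := by
  by_cases h : y = z
  · subst h
    exact Or.inl (τ.rel_refl y)
  · exact τ.isUpperSemilinear x hy hz h

variable {τ} in
theorem Rel.dist_add_dist {x y z : X} (h : τ.Rel x y) (h' : τ.Rel y z) :
    dist x y + dist y z = dist x z :=
  @IsMetricSupSemilattice.dist_add_dist X _ τ.order τ.isMetricSupSemilattice x z y h h'

theorem exists_join (x y : X) :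
    ∃ w, τ.Rel x w ∧ τ.Rel y w ∧ dist x y = dist x w + dist w y := by
  obtain ⟨w, hw⟩ := @IsMetricSupSemilattice.exists_isLUB X _ τ.order τ.isMetricSupSemilattice x y
  exact ⟨w, hw.1 (mem_insert x _), hw.1 (mem_insert_of_mem x rfl),
    @IsMetricSupSemilattice.dist_eq_of_isLUB X _ τ.order τ.isMetricSupSemilattice x y w hw⟩

/-- A join of two points. -/
def join (x y : X) : X := (τ.exists_join x y).choose

theorem rel_join_left (x y : X) : τ.Rel x (τ.join x y) :=
  (τ.exists_join x y).choose_spec.1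

theorem rel_join_right (x y : X) : τ.Rel y (τ.join x y) :=
  (τ.exists_join x y).choose_spec.2.1

theorem dist_join (x y : X) : dist x y = dist x (τ.join x y) + dist (τ.join x y) y :=
  (τ.exists_join x y).choose_spec.2.2

/-- Passing from `v` or `w` up to their join adds the same amount to both distances. This makes the
height well defined up to a constant. -/
theorem dist_sub_dist_eq {x y v w : X} (hxv : τ.Rel x v) (hyv : τ.Rel y v) (hxw : τ.Rel x w)
    (hyw : τ.Rel y w) : dist x v - dist y v = dist x w - dist y w := by
  have h1 := hxv.dist_add_dist (τ.rel_join_left v w)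
  have h2 := hyv.dist_add_dist (τ.rel_join_left v w)
  have h3 := hxw.dist_add_dist (τ.rel_join_right v w)
  have h4 := hyw.dist_add_dist (τ.rel_join_right v w)
  linarith

/-- The height of `y` below the root or the end of `τ`, relative to the height of `o`. -/
def height (o y : X) : ℝ := dist y (τ.join y o) - dist o (τ.join y o)

theorem height_sub_height (o : X) {x y w : X} (hx : τ.Rel x w) (hy : τ.Rel y w) :
    τ.height o x - τ.height o y = dist x w - dist y w := by
  have h1 := τ.dist_sub_dist_eq (τ.rel_join_left x o) (τ.rel_join_right x o)
    (hx.trans (τ.rel_join_left w o)) (τ.rel_join_right w o)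
  have h2 := τ.dist_sub_dist_eq (τ.rel_join_left y o) (τ.rel_join_right y o)
    (hy.trans (τ.rel_join_left w o)) (τ.rel_join_right w o)
  have h3 := hx.dist_add_dist (τ.rel_join_left w o)
  have h4 := hy.dist_add_dist (τ.rel_join_left w o)
  unfold height
  linarith

theorem rel_iff_height (o : X) {x y : X} :
    τ.Rel x y ↔ τ.height o x - τ.height o y = dist x y := by
  constructor
  · intro h
    rw [τ.height_sub_height o h (τ.rel_refl y), dist_self, sub_zero]
  · intro h
    rw [τ.height_sub_height o (τ.rel_join_left x y) (τ.rel_join_right x y),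
      τ.dist_join x y, dist_comm (τ.join x y) y] at h
    have : dist y (τ.join x y) = 0 := by linarith
    have h' := τ.rel_join_left x y
    rwa [← dist_eq_zero.1 this] at h'

/-- On three points the height is, up to a constant, the distance to a common upper bound. The
horofunction conditions involve at most three points, so they pass from distance functions to
heights. -/
theorem exists_height_sub_height (o x y z : X) : ∃ w : X,
    τ.height o x - τ.height o z = dist w x - dist w z ∧
    τ.height o y - τ.height o z = dist w y - dist w z := by
  refine ⟨τ.join (τ.join x y) z, ?_, ?_⟩ <;> rw [dist_comm _ z, dist_comm (τ.join _ _)] <;>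
    apply τ.height_sub_height
  · exact (τ.rel_join_left x y).trans (τ.rel_join_left _ z)
  · exact τ.rel_join_right _ _
  · exact (τ.rel_join_right x y).trans (τ.rel_join_left _ z)
  · exact τ.rel_join_right _ _

theorem isTreeHorofunction_height (hX : IsRTree X) (o : X) : IsTreeHorofunction (τ.height o) where
  sub_le_dist x y := by
    obtain ⟨w, h, -⟩ := τ.exists_height_sub_height o x y y
    rw [h]
    exact (hX.isTreeHorofunction_dist w).sub_le_dist x y
  le_max x y z hz := by
    obtain ⟨w, h, h'⟩ := τ.exists_height_sub_height o x y z
    have := (hX.isTreeHorofunction_dist w).le_max x y z hz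
    rw [le_max_iff] at *
    exact this.imp (fun _ => by linarith) (fun _ => by linarith)

theorem height_sub_le_dist (o x y : X) : τ.height o x - τ.height o y ≤ dist x y := by
  obtain ⟨w, h, -⟩ := τ.exists_height_sub_height o x y y
  rw [h, dist_comm w, dist_comm w]
  linarith [dist_triangle x y w]

theorem lipschitzWith_height (o : X) : LipschitzWith 1 (τ.height o) :=
  LipschitzWith.of_le_add fun x y => by linarith [τ.height_sub_le_dist o x y]

/-- The height as a continuous function. -/
def heightMap (o : X) : C(X, ℝ) := ⟨τ.height o, (τ.lipschitzWith_height o).continuous⟩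

theorem rel_of_dist_add_dist {x y z : X} (h : τ.Rel x y) (hz : dist x z + dist z y = dist x y) :
    τ.Rel x z ∧ τ.Rel z y := by
  have h1 := τ.height_sub_le_dist x x z
  have h2 := τ.height_sub_le_dist x z y
  rw [τ.rel_iff_height x] at h
  rw [τ.rel_iff_height x, τ.rel_iff_height x]
  constructor <;> linarith

theorem dist_eq_abs_of_rel {o x y : X} (hx : τ.Rel o x) (hy : τ.Rel o y) :
    dist x y = |dist o x - dist o y| := by
  rcases τ.rel_or_rel hx hy with h | h
  · have := hx.dist_add_dist h
    rw [abs_of_nonpos (by linarith [dist_nonneg (x := x) (y := y)])]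
    linarith
  · have := hy.dist_add_dist h
    rw [dist_comm y x] at this
    rw [abs_of_nonneg (by linarith [dist_nonneg (x := x) (y := y)])]
    linarith

theorem IsRoot.unique {τ : SemilinearOrder X} {x y : X} (hx : τ.IsRoot x) (hy : τ.IsRoot y) :
    x = y :=
  Rel.antisymm (hy x) (hx y)

theorem isRoot_of_maximal {y : X} (h : ∀ z, τ.Rel y z → z = y) : τ.IsRoot y := fun x => by
  have := τ.rel_join_left x y
  rwa [h _ (τ.rel_join_right x y)] at this

theorem isClosed_upperCone (x : X) : IsClosed (τ.upperCone x) := by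
  have : τ.upperCone x = {y | τ.height x x - τ.height x y = dist x y} :=
    Set.ext fun y => τ.rel_iff_height x
  rw [this]
  have := (τ.lipschitzWith_height x).continuous
  exact isClosed_eq (by fun_prop) (by fun_prop)

/-- In a complete space, an order with a bounded upper cone is rooted. -/
theorem exists_isRoot_of_bounded [CompleteSpace X] {x : X} {R : ℝ}
    (hR : ∀ y, τ.Rel x y → dist x y ≤ R) : ∃ y, τ.Rel x y ∧ τ.IsRoot y := by
  set D : Set ℝ := (fun y => dist x y) '' τ.upperCone x
  have hD : D.Nonempty := ⟨_, x, τ.rel_refl x, rfl⟩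
  have hB : BddAbove D := ⟨R, by rintro _ ⟨y, hy, rfl⟩; exact hR y hy⟩
  obtain ⟨u, -, hu, huD⟩ := exists_seq_tendsto_sSup hD hB
  choose v hv hvu using huD
  -- On the chain above `x`, distances are differences of distances to `x`, so a maximizing sequence
  -- is Cauchy.
  have hc : CauchySeq v := by
    have := hu.cauchySeq
    rw [Metric.cauchySeq_iff] at *
    intro ε hε
    obtain ⟨N, hN⟩ := this ε hε
    refine ⟨N, fun m hm n hn => ?_⟩
    have := hN m hm n hn
    rw [← hvu m, ← hvu n, Real.dist_eq] at this
    rwa [τ.dist_eq_abs_of_rel (hv m) (hv n)]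
  obtain ⟨y, hy⟩ := cauchySeq_tendsto_of_complete hc
  have hxy : τ.Rel x y := (τ.isClosed_upperCone x).mem_of_tendsto hy (Eventually.of_forall hv)
  have hs : dist x y = sSup D := by
    refine tendsto_nhds_unique (tendsto_const_nhds.dist hy) ?_
    convert hu using 2 with n
    exact hvu n
  refine ⟨y, hxy, τ.isRoot_of_maximal fun z hz => ?_⟩
  have h1 : dist x z ≤ sSup D := le_csSup hB ⟨z, hxy.trans hz, rfl⟩
  have h2 := hxy.dist_add_dist hz
  exact (dist_eq_zero.1 (by linarith [dist_nonneg (x := y) (y := z)])).symm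

theorem exists_rel_lt_dist [CompleteSpace X] (hτ : ¬ τ.IsRooted) (x : X) (R : ℝ) :
    ∃ y, τ.Rel x y ∧ R < dist x y := by
  by_contra! h
  obtain ⟨y, -, hy⟩ := τ.exists_isRoot_of_bounded h
  exact hτ ⟨y, hy⟩

/-- The join of `o` and `x` is no farther from `o` than `x`, so on the chain above `o` it comes
before `y`. Hence `Rel o y` determines the height, up to a constant, on the open ball about `o` of
radius `dist o y`. -/
theorem rel_of_dist_lt {o x y : X} (h : τ.Rel o y) (hd : dist o x < dist o y) : τ.Rel x y := by
  have h1 := τ.rel_join_left o x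
  rcases τ.rel_or_rel h1 h with h2 | h2
  · exact (τ.rel_join_right o x).trans h2
  · have h3 := h.dist_add_dist h2
    have h4 := τ.dist_join o x
    linarith [dist_nonneg (x := y) (y := τ.join o x), dist_nonneg (x := τ.join o x) (y := x)]

variable {τ} in
theorem IsRoot.rel_iff {r x y : X} (h : τ.IsRoot r) :
    τ.Rel x y ↔ dist x y + dist y r = dist x r :=
  ⟨fun hxy => hxy.dist_add_dist (h y), fun e => (τ.rel_of_dist_add_dist (h x) e).1⟩

variable {τ} in
theorem IsRoot.height_eq {r : X} (h : τ.IsRoot r) (o x : X) :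
    τ.height o x = dist r x + (τ.height o r) := by
  have := τ.height_sub_height o (h x) (h r)
  rw [dist_self, dist_comm] at this
  linarith

end SemilinearOrder

/-! ### The Hausdorff distance of rooted orders -/

namespace SemilinearOrder

variable {X : Type*} [MetricSpace X]

theorem edist_eq_add_edist (p q : WithLp 1 (X × X)) :
    edist p q = edist p.fst q.fst + edist p.snd q.snd := by
  rw [WithLp.prod_edist_eq_add (by norm_num)]
  simp

theorem IsRoot.exists_edist_le (hX : IsRTree X) {σ τ : SemilinearOrder X} {x y : X}
    (hσ : σ.IsRoot x) (hτ : τ.IsRoot y) (p : WithLp 1 (X × X)) (hp : p ∈ σ.graph) :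
    ∃ q ∈ τ.graph, edist p q ≤ edist x y := by
  have hp' := hσ.rel_iff.1 hp
  -- Either the pair already belongs to `τ`, or its upper point lies between the two roots and can
  -- be moved to `y`.
  rcases hX.dist_add_dist_or hp' y with h | h
  · exact ⟨p, hτ.rel_iff.2 h, by simp⟩
  · refine ⟨WithLp.toLp 1 (p.fst, y), hτ _, ?_⟩
    rw [edist_eq_add_edist]
    simp only [WithLp.toLp_fst, WithLp.toLp_snd, edist_self, zero_add, edist_dist]
    exact ENNReal.ofReal_le_ofReal (by linarith [dist_nonneg (x := x) (y := p.snd)])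

theorem IsRoot.hausdorffEDist_eq (hX : IsRTree X) {σ τ : SemilinearOrder X} {x y : X}
    (hσ : σ.IsRoot x) (hτ : τ.IsRoot y) :
    Metric.hausdorffEDist σ.graph τ.graph = edist x y := by
  apply le_antisymm
  · apply Metric.hausdorffEDist_le_of_mem_edist
    · exact fun p hp => hσ.exists_edist_le hX hτ p hp
    · rw [edist_comm]
      exact fun p hp => hτ.exists_edist_le hX hσ p hp
  -- The pair `(x, y)` is far from `σ`: for a pair in `σ` the lower point is at least as far from
  -- `x` as the upper one.
  · have hmem : WithLp.toLp 1 (x, y) ∈ τ.graph := hτ x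
    rw [Metric.hausdorffEDist_comm]
    refine le_trans ?_ (Metric.infEDist_le_hausdorffEDist_of_mem hmem)
    rw [Metric.le_infEDist]
    intro p hp
    rw [edist_eq_add_edist]
    simp only [edist_dist]
    rw [← ENNReal.ofReal_add dist_nonneg dist_nonneg]
    apply ENNReal.ofReal_le_ofReal
    have h1 := hσ.rel_iff.1 hp
    have h2 := dist_triangle x p.snd y
    rw [dist_comm p.snd x, dist_comm p.fst x] at h1
    rw [dist_comm p.snd y] at h2
    change dist x y ≤ dist x p.fst + dist y p.snd
    linarith [dist_nonneg (x := p.fst) (y := p.snd)]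

end SemilinearOrder

/-! ### Rooted orders and points of the tree -/

section Root

variable {X : Type*} [MetricSpace X]

/-- The order with root `x`. -/
def IsRTree.rootedAt (hX : IsRTree X) (x : X) : SemilinearOrder X :=
  (hX.isTreeHorofunction_dist x).semilinearOrder hX

theorem IsRTree.isRoot_rootedAt (hX : IsRTree X) (x : X) : (hX.rootedAt x).IsRoot x := by
  intro y
  refine ((hX.isTreeHorofunction_dist x).semilinearOrder_rel hX y x).2 ?_
  simp [dist_comm]

theorem SemilinearOrder.IsRoot.ext {σ τ : SemilinearOrder X} {x : X} (hσ : σ.IsRoot x)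
    (hτ : τ.IsRoot x) : σ = τ :=
  SemilinearOrder.ext_rel fun _ _ => hσ.rel_iff.trans hτ.rel_iff.symm

/-- Sending a rooted order to its root. -/
def IsRTree.rootEquiv (hX : IsRTree X) : RootedOrder X ≃ᵢ X where
  toFun τ := τ.isRooted.choose
  invFun x := ⟨hX.rootedAt x, x, hX.isRoot_rootedAt x⟩
  left_inv τ := by
    obtain ⟨τ, h⟩ := τ
    have := (hX.isRoot_rootedAt _).ext h.choose_spec
    simp only [this]
  right_inv x := by
    have h : (hX.rootedAt x).IsRooted := ⟨x, hX.isRoot_rootedAt x⟩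
    exact h.choose_spec.unique (hX.isRoot_rootedAt x)
  isometry_toFun σ τ :=
    (σ.isRooted.choose_spec.hausdorffEDist_eq hX τ.isRooted.choose_spec).symm

theorem IsRTree.isRoot_rootEquiv (hX : IsRTree X) (τ : RootedOrder X) :
    τ.val.IsRoot (hX.rootEquiv τ) :=
  τ.isRooted.choose_spec

end Root

/-! ### Rays -/

namespace SemilinearOrder

variable {X : Type*} [MetricSpace X] (τ : SemilinearOrder X)

theorem exists_isRay_range_eq_upperCone [CompleteSpace X] (hX : IsRTree X) (hτ : ¬ τ.IsRooted)
    (x : X) : ∃ c : ℝ≥0 → X, IsRay c ∧ c 0 = x ∧ range c = τ.upperCone x := by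
  have H : ∀ t : ℝ≥0, ∃ y, τ.Rel x y ∧ dist x y = t := by
    intro t
    obtain ⟨w, hw, hd⟩ := τ.exists_rel_lt_dist hτ x t
    obtain ⟨z, h1, h2⟩ := hX.exists_dist_eq x w (t := t) ⟨t.2, hd.le⟩
    exact ⟨z, (τ.rel_of_dist_add_dist hw (by linarith)).1, h1⟩
  choose c hc hd using H
  refine ⟨c, ?_, ?_, ?_⟩
  · refine Isometry.of_dist_eq fun s t => ?_
    rw [τ.dist_eq_abs_of_rel (hc s) (hc t), hd, hd, NNReal.dist_eq]
  · exact (dist_eq_zero.1 (hd 0)).symm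
  · ext y
    constructor
    · rintro ⟨t, rfl⟩
      exact hc t
    · intro hy
      refine ⟨nndist x y, ?_⟩
      rw [← dist_eq_zero, τ.dist_eq_abs_of_rel (hc _) hy, hd]
      simp

/-- A ray asymptotic to an upper cone is increasing. -/
theorem rel_of_asymptotic (hX : IsRTree X) {x : X} {c c' : ℝ≥0 → X} (hc : IsRay c)
    (h0 : c 0 = x) (hr : range c ⊆ τ.upperCone x) (hc' : IsRay c') (ha : Asymptotic c' c)
    {s t : ℝ≥0} (hst : s ≤ t) : τ.Rel (c' s) (c' t) := by
  obtain ⟨C, hC⟩ := ha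
  have hst' : (s : ℝ) ≤ t := hst
  have hle : ∀ u : ℝ≥0, τ.height x (c' u) ≤ τ.height x x - u + C := by
    intro u
    have h1 := (τ.rel_iff_height x).1 (hr ⟨u, rfl⟩)
    have h2 := hc.dist_eq 0 u
    rw [h0, NNReal.dist_eq] at h2
    simp only [NNReal.coe_zero, zero_sub, abs_neg, NNReal.abs_eq] at h2
    have h3 := τ.height_sub_le_dist x (c' u) (c u)
    linarith [hC u]
  have hdist : ∀ {u v : ℝ≥0}, u ≤ v → dist (c' u) (c' v) = v - u := by
    intro u v huv
    have huv' : (u : ℝ) ≤ v := huv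
    rw [hc'.dist_eq, NNReal.dist_eq, abs_of_nonpos (by linarith)]
    ring
  obtain ⟨n, hn⟩ := exists_nat_gt (|τ.height x x| + |C| + |τ.height x (c' t)| + t)
  have ha1 := le_abs_self (τ.height x x)
  have ha2 := le_abs_self C
  have ha3 := neg_abs_le (τ.height x (c' t))
  have ha4 := abs_nonneg (τ.height x x)
  have ha5 := abs_nonneg C
  have ha6 := abs_nonneg (τ.height x (c' t))
  have htn : t ≤ (n : ℝ≥0) := by
    have : (t : ℝ) ≤ ((n : ℝ≥0) : ℝ) := by
      push_cast
      linarith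
    exact this
  -- Were the height not descending from `c' s` to `c' t`, it would have to ascend from `c' t` to
  -- `c' n`, against the bound `hle` for this large `n`.
  have hm := (τ.isTreeHorofunction_height hX x).le_max (c' s) (c' n) (c' t) (by
    rw [hdist hst, hdist htn, hdist (hst.trans htn)]
    ring)
  rw [dist_comm (c' n), hdist hst, hdist htn, le_max_iff] at hm
  have hln := hle n
  push_cast at hm hln
  rw [τ.rel_iff_height x]
  apply le_antisymm (τ.height_sub_le_dist x _ _)
  rw [hdist hst]
  rcases hm with hm | hm <;> linarith [t.2]

/-- The Busemann limit is eventually constant: once `t` exceeds `dist (c' 0) y`, both `y` and `c' 0`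
are below `c' t`. -/
theorem isBusemannFunction_of_asymptotic (hX : IsRTree X) (o : X) {x : X} {c c' : ℝ≥0 → X}
    (hc : IsRay c) (h0 : c 0 = x) (hr : range c ⊆ τ.upperCone x) (hc' : IsRay c')
    (ha : Asymptotic c' c) :
    IsBusemannFunction c' (τ.heightMap o + ContinuousMap.const X (-τ.height o (c' 0))) := by
  have hmono : ∀ {s t : ℝ≥0}, s ≤ t → τ.Rel (c' s) (c' t) := fun h =>
    τ.rel_of_asymptotic hX hc h0 hr hc' ha h
  have hdist : ∀ t : ℝ≥0, dist (c' 0) (c' t) = t := fun t => by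
    rw [hc'.dist_eq, NNReal.dist_eq]
    simp
  intro y
  refine tendsto_const_nhds.congr' ?_
  filter_upwards [eventually_gt_atTop (nndist (c' 0) y)] with t ht
  have ht' : dist (c' 0) y < dist (c' 0) (c' t) := by
    rw [hdist]
    exact ht
  have h1 := (τ.rel_iff_height o).1 (τ.rel_of_dist_lt (hmono (zero_le (a := t))) ht')
  have h2 := (τ.rel_iff_height o).1 (hmono (zero_le (a := t)))
  rw [hdist] at h2
  change τ.height o y + -τ.height o (c' 0) = _
  linarith

end SemilinearOrder

/-! ### Classes modulo constants -/

section ModConst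

variable {X : Type*} [TopologicalSpace X]

theorem classModConst_eq_iff {f g : C(X, ℝ)} :
    classModConst f = classModConst g ↔ ∀ x y, f x - f y = g x - g y := by
  have h : classModConst f = classModConst g ↔ f - g ∈ constFunctions X :=
    Submodule.Quotient.eq _
  rw [h]
  constructor
  · rintro ⟨a, ha⟩ x y
    have h1 : f x - g x = a := DFunLike.congr_fun ha x
    have h2 : f y - g y = a := DFunLike.congr_fun ha y
    linarith
  · intro H
    rcases isEmpty_or_nonempty X with hE | ⟨⟨x⟩⟩
    · exact ⟨0, ContinuousMap.ext fun x => (hE.false x).elim⟩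
    · refine ⟨f x - g x, ContinuousMap.ext fun y => ?_⟩
      change f y - g y = f x - g x
      linarith [H x y]

theorem isOpenQuotientMap_classModConst : IsOpenQuotientMap (classModConst (X := X)) :=
  (constFunctions X).isOpenQuotientMap_mkQ

theorem ContinuousMap.exists_isCompact_forall_eqOn_mem {f : C(X, ℝ)} {W : Set C(X, ℝ)}
    (hW : W ∈ 𝓝 f) : ∃ K, IsCompact K ∧ ∀ g : C(X, ℝ), EqOn f g K → g ∈ W := by
  obtain ⟨S, ⟨hS, hSK⟩, hSW⟩ := f.hasBasis_nhds.mem_iff.1 hW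
  refine ⟨⋃ KU ∈ S, KU.1, hS.isCompact_biUnion fun KU h => (hSK KU.1 KU.2 h).1,
    fun g hg => hSW ?_⟩
  simp only [mem_iInter]
  intro KU h x hx
  have hmem : x ∈ ⋃ KU ∈ S, KU.1 := mem_biUnion h hx
  rw [← hg hmem]
  exact (hSK KU.1 KU.2 h).2.2 hx

end ModConst

/-! ### Height classes and the metric compactification -/

section Compactification

variable {X : Type*} [MetricSpace X]

theorem isClosed_setOf_isTreeHorofunction :
    IsClosed {f : C(X, ℝ) | IsTreeHorofunction f} := by
  have : {f : C(X, ℝ) | IsTreeHorofunction f} =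
      {f : C(X, ℝ) | ∀ x y, f x - f y ≤ dist x y} ∩ {f : C(X, ℝ) | ∀ x y z,
        dist x z + dist z y = dist x y → f z ≤ max (f x - dist x z) (f y - dist y z)} :=
    Set.ext fun f => ⟨fun h => ⟨h.1, h.2⟩, fun h => ⟨h.1, h.2⟩⟩
  rw [this]
  simp only [ofPred_forall]
  have he : ∀ x : X, Continuous fun f : C(X, ℝ) => f x := continuous_eval_const
  refine IsClosed.inter ?_ ?_
  · exact isClosed_iInter fun x => isClosed_iInter fun y =>
      isClosed_le ((he x).sub (he y)) continuous_const
  · exact isClosed_iInter fun x => isClosed_iInter fun y => isClosed_iInter fun z =>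
      isClosed_iInter fun _ => isClosed_le (he z)
        (((he x).sub continuous_const).max ((he y).sub continuous_const))

theorem isTreeHorofunction_of_mem_metricCompactification (hX : IsRTree X) {f : C(X, ℝ)}
    (hf : classModConst f ∈ metricCompactification X) : IsTreeHorofunction f := by
  -- The quotient map is open, so closures commute with preimages and the question moves to
  -- functions.
  have h1 : f ∈ closure (classModConst ⁻¹' range fun x : X => classModConst (distFunction x)) := by
    rwa [← isOpenQuotientMap_classModConst.isOpenMap.preimage_closure_eq_closure_preimage
      isOpenQuotientMap_classModConst.continuous]
  refine closure_minimal ?_ isClosed_setOf_isTreeHorofunction h1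
  rintro g ⟨w, hw⟩
  have hw' := classModConst_eq_iff.1 hw
  have hd := hX.isTreeHorofunction_dist w
  refine ⟨fun x y => ?_, fun x y z h => ?_⟩
  · rw [← hw']
    exact hd.sub_le_dist x y
  · have h1 : dist w x - dist w z = g x - g z := hw' x z
    have h2 : dist w y - dist w z = g y - g z := hw' y z
    exact le_max_iff.2
      ((le_max_iff.1 (hd.le_max x y z h)).imp (fun _ => by linarith) (fun _ => by linarith))

namespace SemilinearOrder

/-- The class modulo constants of the height of `τ`. -/
def heightClass (o : X) (τ : SemilinearOrder X) : FunctionsModConst X :=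
  classModConst (τ.heightMap o)

theorem heightClass_eq_iff {o : X} {τ : SemilinearOrder X} {f : C(X, ℝ)} :
    τ.heightClass o = classModConst f ↔ ∀ x y, τ.height o x - τ.height o y = f x - f y :=
  classModConst_eq_iff

theorem IsRoot.heightClass_eq {τ : SemilinearOrder X} {x : X} (h : τ.IsRoot x) (o : X) :
    τ.heightClass o = classModConst (distFunction x) := by
  rw [heightClass_eq_iff]
  intro y z
  rw [h.height_eq o y, h.height_eq o z]
  change _ = dist x y - dist x z
  ring

theorem heightClass_injective (o : X) : Function.Injective (heightClass (X := X) o) := by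
  intro σ τ h
  have h' := heightClass_eq_iff.1 h
  refine ext_rel fun x y => ?_
  rw [σ.rel_iff_height o, τ.rel_iff_height o, h']
  rfl

theorem _root_.IsTreeHorofunction.heightClass_semilinearOrder (hX : IsRTree X) (o : X)
    {f : C(X, ℝ)} (hf : IsTreeHorofunction f) :
    (hf.semilinearOrder hX).heightClass o = classModConst f := by
  rw [heightClass_eq_iff]
  intro x y
  set τ := hf.semilinearOrder hX
  have hx := τ.rel_join_left x y
  have hy := τ.rel_join_right x y
  rw [τ.height_sub_height o hx hy, ← (hf.semilinearOrder_rel hX _ _).1 hx,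
    ← (hf.semilinearOrder_rel hX _ _).1 hy]
  ring

/-- The orders in which a remote point of an upper cone of an unrooted order `τ` is above `o` have
classes close to the class of `τ`. -/
theorem exists_forall_heightClass_mem [CompleteSpace X] {τ : SemilinearOrder X}
    (hτ : ¬ τ.IsRooted) (o : X) {W : Set (FunctionsModConst X)} (hW : W ∈ 𝓝 (τ.heightClass o)) :
    ∃ y, o ≠ y ∧ τ.Rel o y ∧ ∀ σ : SemilinearOrder X, σ.Rel o y → σ.heightClass o ∈ W := by
  have hW' := (isOpenQuotientMap_classModConst (X := X)).continuous.continuousAt.preimage_mem_nhds hW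
  obtain ⟨K, hK, hKW⟩ := ContinuousMap.exists_isCompact_forall_eqOn_mem hW'
  obtain ⟨R, hR⟩ := hK.isBounded.subset_closedBall o
  -- The point is taken outside a ball containing `K`; the `0` guarantees `o ≠ y`.
  obtain ⟨y, hy, hRy⟩ := τ.exists_rel_lt_dist hτ o (max R 0)
  rw [max_lt_iff] at hRy
  refine ⟨y, dist_pos.1 hRy.2, hy, fun σ hσ => ?_⟩
  have hg : σ.heightClass o =
      classModConst (σ.heightMap o + ContinuousMap.const X (τ.height o y - σ.height o y)) := by
    rw [heightClass_eq_iff]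
    intro a b
    change _ = (σ.height o a + _) - (σ.height o b + _)
    simp
  rw [hg]
  refine hKW _ fun x hx => ?_
  have hd : dist o x < dist o y := by
    rw [dist_comm]
    exact (hR hx).trans_lt hRy.1
  have h1 := (τ.rel_iff_height o).1 (τ.rel_of_dist_lt hy hd)
  have h2 := (σ.rel_iff_height o).1 (σ.rel_of_dist_lt hσ hd)
  change τ.height o x = σ.height o x + (τ.height o y - σ.height o y)
  linarith

theorem heightClass_mem_metricCompactification [CompleteSpace X] (hX : IsRTree X) (o : X)
    (τ : SemilinearOrder X) : τ.heightClass o ∈ metricCompactification X := by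
  by_cases hτ : τ.IsRooted
  · obtain ⟨x, hx⟩ := hτ
    exact subset_closure ⟨x, (hx.heightClass_eq o).symm⟩
  · refine mem_closure_iff_nhds.2 fun W hW => ?_
    obtain ⟨y, -, -, h⟩ := exists_forall_heightClass_mem hτ o hW
    have hy := hX.isRoot_rootedAt y
    exact ⟨_, h _ (hy o), y, (hy.heightClass_eq o).symm⟩

theorem continuous_heightClass [CompleteSpace X] (hX : IsRTree X) (o : X) :
    Continuous (heightClass (X := X) o) := by
  refine continuous_def.2 fun W hW => isOpen_iff_mem_nhds.2 fun τ hτW => ?_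
  by_cases hτ : τ.IsRooted
  · have hc : Continuous fun x : X => classModConst (distFunction x) := by
      refine isOpenQuotientMap_classModConst.continuous.comp ?_
      refine ContinuousMap.continuous_of_continuous_uncurry _ ?_
      exact continuous_dist
    have hV := (hW.preimage hc).preimage hX.rootEquiv.continuous
    refine mem_of_superset (IsOpen.mem_nhds
      (TopologicalSpace.isOpen_generateFrom_of_mem (Or.inl ⟨_, hV, rfl⟩))
      ⟨⟨τ, hτ⟩, ?_, rfl⟩) ?_
    · change classModConst _ ∈ W
      rwa [← (hX.isRoot_rootEquiv ⟨τ, hτ⟩).heightClass_eq o]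
    · rintro _ ⟨σ, hσ, rfl⟩
      change heightClass o _ ∈ W
      rw [(hX.isRoot_rootEquiv σ).heightClass_eq o]
      exact hσ
  · obtain ⟨y, hoy, hy, h⟩ := exists_forall_heightClass_mem hτ o (hW.mem_nhds hτW)
    refine mem_of_superset (IsOpen.mem_nhds
      (TopologicalSpace.isOpen_generateFrom_of_mem (Or.inr ⟨o, y, hoy, rfl⟩))
      ⟨hy, fun hr => hτ ⟨y, hr⟩⟩) fun σ hσ => h σ hσ.1

/-- Orders with classes close to the class of a rooted order are rooted, at a near point. -/
theorem IsRoot.exists_isOpen_heightClass [CompleteSpace X] [LocallyCompactSpace X]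
    (hX : IsRTree X) (o : X) {τ : SemilinearOrder X} {x : X} (hx : τ.IsRoot x) {r : ℝ}
    (hr : 0 < r) :
    ∃ W, IsOpen W ∧ τ.heightClass o ∈ W ∧
      ∀ σ : SemilinearOrder X, σ.heightClass o ∈ W → ∃ y, dist x y < r ∧ σ.IsRoot y := by
  obtain ⟨r', hr', hK⟩ := Metric.exists_isCompact_closedBall x
  set s := min r r'
  have hs : 0 < s := lt_min hr hr'
  have hK' : IsCompact (Metric.closedBall x s) :=
    hK.of_isClosed_subset Metric.isClosed_closedBall
      (Metric.closedBall_subset_closedBall (min_le_right _ _))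
  -- `D` ignores constants. The open set asks that `f` drop by less than `s` from `x` on the compact
  -- ball; since heights drop at unit rate along upper cones, the cone of `x` cannot reach distance
  -- `s`.
  let D : C(X, ℝ) → C(X, ℝ) := fun f => ContinuousMap.const X (f x) - f
  have hD : Continuous D :=
    (ContinuousMap.continuous_const'.comp (continuous_eval_const x)).sub continuous_id
  have hO : IsOpen {f | MapsTo (D f) (Metric.closedBall x s) (Iio s)} :=
    (ContinuousMap.isOpen_setOfPred_mapsTo hK' isOpen_Iio).preimage hD
  refine ⟨_, isOpenQuotientMap_classModConst.isOpenMap _ hO, ⟨_, fun z _ => ?_, rfl⟩, ?_⟩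
  · change τ.height o x - τ.height o z < s
    rw [hx.height_eq o z, hx.height_eq o x, dist_self]
    linarith [dist_nonneg (x := x) (y := z)]
  · rintro σ ⟨f, hf, hfσ⟩
    have hσ := heightClass_eq_iff.1 hfσ.symm
    have hb : ∀ y, σ.Rel x y → dist x y < s := by
      intro y hy
      by_contra! hsy
      obtain ⟨z, h1, h2⟩ := hX.exists_dist_eq x y ⟨hs.le, hsy⟩
      have hz := (σ.rel_of_dist_add_dist hy (z := z) (by linarith)).1
      have hlt : f x - f z < s := hf (by rw [Metric.mem_closedBall, dist_comm, h1])
      rw [σ.rel_iff_height o, hσ] at hz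
      linarith
    obtain ⟨y, hxy, hy⟩ := σ.exists_isRoot_of_bounded fun y hy => (hb y hy).le
    exact ⟨y, (hb y hxy).trans_le (min_le_left _ _), hy⟩

theorem exists_isOpen_heightClass_basicNhd (hX : IsRTree X) (o : X) {τ : SemilinearOrder X}
    {x y : X} (hτ : τ ∈ basicNhd x y) :
    ∃ W, IsOpen W ∧ τ.heightClass o ∈ W ∧
      ∀ σ : SemilinearOrder X, σ.heightClass o ∈ W → σ ∈ basicNhd x y := by
  obtain ⟨hxy, hy⟩ := hτ
  -- A witness that `y` is not the root. Near `τ` the height does not ascend with slope `1` from `y`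
  -- to `z`, so it must descend with slope `-1` from `x` to `y`; and `y` stays a non-root.
  obtain ⟨z, hyz, hne⟩ : ∃ z, τ.Rel y z ∧ z ≠ y := by
    by_contra! h
    exact hy (τ.isRoot_of_maximal h)
  have hO : IsOpen {f : C(X, ℝ) | f z - f y < dist y z} :=
    isOpen_lt ((continuous_eval_const z).sub
      (continuous_eval_const y)) continuous_const
  refine ⟨_, isOpenQuotientMap_classModConst.isOpenMap _ hO, ⟨_, ?_, rfl⟩, ?_⟩
  · change τ.height o z - τ.height o y < dist y z
    have h1 := (τ.rel_iff_height o).1 hyz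
    linarith [dist_pos.2 hne.symm]
  · rintro σ ⟨f, hf, hfσ⟩
    have hσ : σ.height o z - σ.height o y < dist y z := by
      rw [heightClass_eq_iff.1 hfσ.symm]
      exact hf
    refine ⟨?_, fun hr => ?_⟩
    · have h1 := (σ.isTreeHorofunction_height hX o).le_max x z y (hxy.dist_add_dist hyz)
      change σ.Rel x y
      rw [σ.rel_iff_height o]
      refine le_antisymm (σ.height_sub_le_dist o x y) ?_
      rw [dist_comm z y, le_max_iff] at h1
      rcases h1 with h1 | h1 <;> linarith
    · have h1 := (σ.rel_iff_height o).1 (hr z)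
      rw [dist_comm] at h1
      linarith

/-- The bijection of the semilinear orders with the metric compactification. -/
def equivMetricCompactification [CompleteSpace X] (hX : IsRTree X) (o : X) :
    SemilinearOrder X ≃ metricCompactification X :=
  Equiv.ofBijective
    (fun τ => ⟨τ.heightClass o, τ.heightClass_mem_metricCompactification hX o⟩) <| by
      refine ⟨fun σ τ h => heightClass_injective o (congrArg Subtype.val h), ?_⟩
      rintro ⟨ξ, hξ⟩
      obtain ⟨f, rfl⟩ := isOpenQuotientMap_classModConst.surjective ξ
      have hf := isTreeHorofunction_of_mem_metricCompactification hX hξ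
      exact ⟨hf.semilinearOrder hX, Subtype.ext (hf.heightClass_semilinearOrder hX o)⟩

/-- The homeomorphism of the space of semilinear orders with the metric compactification. -/
def homeomorphMetricCompactification [CompleteSpace X] [LocallyCompactSpace X] (hX : IsRTree X)
    (o : X) : SemilinearOrder X ≃ₜ metricCompactification X where
  toEquiv := equivMetricCompactification hX o
  continuous_toFun := (continuous_heightClass hX o).subtype_mk _
  continuous_invFun := by
    set e : SemilinearOrder X ≃ metricCompactification X := equivMetricCompactification hX o
    change Continuous e.symm
    have he : ∀ τ, (e τ : FunctionsModConst X) = τ.heightClass o := fun _ => rfl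
    have key : ∀ B : Set (SemilinearOrder X), (∀ τ ∈ B, ∃ W, IsOpen W ∧ τ.heightClass o ∈ W ∧
        ∀ σ : SemilinearOrder X, σ.heightClass o ∈ W → σ ∈ B) → IsOpen (e.symm ⁻¹' B) := by
      intro B hB
      refine isOpen_iff_mem_nhds.2 fun ξ hξ => ?_
      obtain ⟨W, hW, hξW, h⟩ := hB _ hξ
      rw [← he, e.apply_symm_apply] at hξW
      refine mem_of_superset ((hW.preimage continuous_subtype_val).mem_nhds hξW) fun η hη => h _ ?_
      rwa [← he, e.apply_symm_apply]
    refine continuous_generateFrom_iff.2 fun B hB => key B ?_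
    rcases hB with ⟨V, hV, rfl⟩ | ⟨x, y, -, rfl⟩
    · rintro _ ⟨τ, hτ, rfl⟩
      have hV' : IsOpen (hX.rootEquiv.symm ⁻¹' V) := hV.preimage hX.rootEquiv.symm.continuous
      obtain ⟨r, hr, hb⟩ := Metric.isOpen_iff.1 hV' (hX.rootEquiv τ) (by simpa using hτ)
      obtain ⟨W, hW, hτW, h⟩ := (hX.isRoot_rootEquiv τ).exists_isOpen_heightClass hX o hr
      refine ⟨W, hW, hτW, fun σ hσ => ?_⟩
      obtain ⟨y, hy, hσy⟩ := h σ hσ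
      refine ⟨hX.rootEquiv.symm y, hb ?_, (hX.isRoot_rootedAt y).ext hσy⟩
      rwa [Metric.mem_ball, dist_comm]
    · exact fun τ hτ => exists_isOpen_heightClass_basicNhd hX o hτ

theorem coe_homeomorphMetricCompactification [CompleteSpace X] [LocallyCompactSpace X]
    (hX : IsRTree X) (o : X) (τ : SemilinearOrder X) :
    (homeomorphMetricCompactification hX o τ : FunctionsModConst X) = τ.heightClass o :=
  rfl

end SemilinearOrder

end Compactification

end

theorem theorem2 (X : Type*) [MetricSpace X] [CompleteSpace X] [LocallyCompactSpace X]
    [Nonempty X] (hX : IsRTree X) :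
    -- the Hausdorff distance of two rooted orders is the distance of their roots
    (∀ (σ τ : SemilinearOrder X) (x y : X), σ.IsRoot x → τ.IsRoot y →
      Metric.hausdorffEDist σ.graph τ.graph = edist x y) ∧
    -- taking the root is an isometry of the space of rooted orders onto `X`
    (∃ e : RootedOrder X ≃ᵢ X, ∀ τ : RootedOrder X, τ.val.IsRoot (e τ)) ∧
    -- sending an order to its root or to its end at infinity is a homeomorphism
    (∃ Φ : SemilinearOrder X ≃ₜ metricCompactification X,
      (∀ (τ : SemilinearOrder X) (x : X), τ.IsRoot x →
        (Φ τ : FunctionsModConst X) = classModConst (distFunction x)) ∧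
      (∀ τ : SemilinearOrder X, ¬ τ.IsRooted → ∀ x : X,
        ∃ c : ℝ≥0 → X, IsRay c ∧ c 0 = x ∧ range c = τ.upperCone x ∧
          ∀ c' : ℝ≥0 → X, IsRay c' → Asymptotic c' c →
            ∃ β : C(X, ℝ), IsBusemannFunction c' β ∧
              (Φ τ : FunctionsModConst X) = classModConst β)) := by
  obtain ⟨o⟩ := ‹Nonempty X›
  refine ⟨fun σ τ x y hσ hτ => hσ.hausdorffEDist_eq hX hτ, ⟨hX.rootEquiv, hX.isRoot_rootEquiv⟩,
    SemilinearOrder.homeomorphMetricCompactification hX o, fun τ x hx => ?_,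
    fun τ hτ x => ?_⟩
  · rw [SemilinearOrder.coe_homeomorphMetricCompactification, hx.heightClass_eq]
  obtain ⟨c, hc, h0, hr⟩ := τ.exists_isRay_range_eq_upperCone hX hτ x
  refine ⟨c, hc, h0, hr, fun c' hc' ha => ⟨_,
    τ.isBusemannFunction_of_asymptotic hX o hc h0 hr.subset hc' ha, ?_⟩⟩
  rw [SemilinearOrder.coe_homeomorphMetricCompactification, SemilinearOrder.heightClass_eq_iff]
  intro a b
  change _ = (τ.height o a + -τ.height o (c' 0)) - (τ.height o b + -τ.height o (c' 0))
  ring
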